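/- Let $k,m,r,t$ be nonnegative integers, $A_1\in\mathbb R^{k\times m}$, $A_2\in\mathbb R^{k\times r}$ and $\delta>0$. A vector is $t$-sparse if at most $t$ of its components are non-zero. The restricted isometry (RIP) constant of order $t$ of a matrix $B$ is the smallest $\epsilon>0$ (understood as an infimum) such that $(1-\epsilon)\|x\|_2^2\le\|Bx\|_2^2\le(1+\epsilon)\|x\|_2^2$ for every $t$-sparse vector $x$. We say that $A=(A_1,A_2)$ has the partial RIP of order $t$ with constant at most $\delta$ if $A_2$ has full column rank and the RIP constant of order $t$ of the matrix $\mathcal P A_1$ is at most $\delta$, where $\mathcal P=I-A_2(A_2^\top A_2)^{-1}A_2^\top$ is the orthogonal projection onto the orthogonal complement of the range of $A_2$. **Theorem.** There are absolute constants $C,c>0$ such that the following holds. Let $N\ge 1$, $0\le r\le s\le N$ and $k\ge 0$ be integers and let $0<\delta<1$. Let $A=(A_1,A_2)$ be a random matrix, with $A_1$ of size $k\times(N-r)$ and $A_2$ of size $k\times r$, whose entries are independent Gaussian random variables with mean $0$ and variance $1/k$. If $$k>\frac{2\cdot 48}{3\delta^2-\delta^3}\left((s-r)\log\left(\frac{N-r}{s-r}\,e\right)+s\log\left(\frac{12}{\delta}\right)\right),$$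 where the first summand is read as $0$ if $s=r$, then the probability that $A$ does not have the partial RIP of order $s-r$ with constant at most $\delta$ is at most $C N^{-c}$. -/

import Mathlib

open MeasureTheory ProbabilityTheory

/-- The vector `x` is `s`-sparse: at most `s` of its components are non-zero. -/
def IsSparse {n : ℕ} (s : ℕ) (x : EuclideanSpace ℝ (Fin n)) : Prop :=
  hammingNorm (fun i => x i) ≤ s

/-- The restricted isometry inequalities of order `s` for the matrix `A`, with bound `δ`:
`(1 - δ) ‖x‖₂² ≤ ‖A x‖₂² ≤ (1 + δ) ‖x‖₂²` for every `s`-sparse vector `x`. -/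
def RestrictedIsometry {k n : ℕ} (A : Matrix (Fin k) (Fin n) ℝ) (s : ℕ) (δ : ℝ) : Prop :=
  ∀ x : EuclideanSpace ℝ (Fin n), IsSparse s x →
    (1 - δ) * ‖x‖ ^ 2 ≤ ‖Matrix.toEuclideanLin A x‖ ^ 2 ∧
      ‖Matrix.toEuclideanLin A x‖ ^ 2 ≤ (1 + δ) * ‖x‖ ^ 2

/-- The restricted isometry constant of order `s`: the smallest `δ > 0` for which the
restricted isometry inequalities hold (as an infimum; see `ripConstant_le_iff`). -/
noncomputable def ripConstant {k n : ℕ} (A : Matrix (Fin k) (Fin n) ℝ) (s : ℕ) : ℝ :=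
  sInf {δ : ℝ | 0 < δ ∧ RestrictedIsometry A s δ}

theorem RestrictedIsometry.mono {k n s : ℕ} {A : Matrix (Fin k) (Fin n) ℝ} {δ ε : ℝ}
    (h : RestrictedIsometry A s δ) (hle : δ ≤ ε) : RestrictedIsometry A s ε := by
  intro x hx
  obtain ⟨h1, h2⟩ := h x hx
  constructor <;> nlinarith [sq_nonneg ‖x‖]

theorem exists_restrictedIsometry {k n : ℕ} (A : Matrix (Fin k) (Fin n) ℝ) (s : ℕ) :
    ∃ δ : ℝ, 0 < δ ∧ RestrictedIsometry A s δ := by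
  set T := (Matrix.toEuclideanLin A).toContinuousLinearMap with hT
  refine ⟨1 + ‖T‖ ^ 2, by positivity, fun x _ => ⟨?_, ?_⟩⟩
  · nlinarith [sq_nonneg ‖x‖, sq_nonneg ‖Matrix.toEuclideanLin A x‖,
      mul_nonneg (sq_nonneg ‖T‖) (sq_nonneg ‖x‖)]
  · have h : ‖Matrix.toEuclideanLin A x‖ ≤ ‖T‖ * ‖x‖ := T.le_opNorm x
    have h2 := pow_le_pow_left₀ (norm_nonneg _) h 2
    nlinarith [sq_nonneg ‖x‖]

/-- The infimum defining the constant is not a junk value: a number `δ > 0` bounds the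
constant exactly when the restricted isometry inequalities hold with `δ`. -/
theorem ripConstant_le_iff {k n : ℕ} (A : Matrix (Fin k) (Fin n) ℝ) (s : ℕ) {δ : ℝ}
    (hδ : 0 < δ) : ripConstant A s ≤ δ ↔ RestrictedIsometry A s δ := by
  constructor
  · intro h
    have key : ∀ ε : ℝ, 0 < ε → RestrictedIsometry A s (δ + ε) := by
      intro ε hε
      have hlt : sInf {δ : ℝ | 0 < δ ∧ RestrictedIsometry A s δ} < δ + ε :=
        lt_of_le_of_lt h (by linarith)
      obtain ⟨d, hd, hlt'⟩ := exists_lt_of_csInf_lt (exists_restrictedIsometry A s) hlt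
      exact hd.2.mono hlt'.le
    intro x hx
    have hlim (c : ℝ) : Filter.Tendsto (fun ε : ℝ => (c + ε) * ‖x‖ ^ 2)
        (nhdsWithin 0 (Set.Ioi 0)) (nhds (c * ‖x‖ ^ 2)) := by
      have : Continuous (fun ε : ℝ => (c + ε) * ‖x‖ ^ 2) := by fun_prop
      simpa using (this.tendsto 0).mono_left nhdsWithin_le_nhds
    have hlim' : Filter.Tendsto (fun ε : ℝ => (1 - (δ + ε)) * ‖x‖ ^ 2)
        (nhdsWithin 0 (Set.Ioi 0)) (nhds ((1 - δ) * ‖x‖ ^ 2)) := by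
      have : Continuous (fun ε : ℝ => (1 - (δ + ε)) * ‖x‖ ^ 2) := by fun_prop
      simpa using (this.tendsto 0).mono_left nhdsWithin_le_nhds
    constructor
    · refine le_of_tendsto hlim' ?_
      filter_upwards [self_mem_nhdsWithin] with ε hε
      exact (key ε hε x hx).1
    · refine ge_of_tendsto (hlim (1 + δ)) ?_
      filter_upwards [self_mem_nhdsWithin] with ε hε
      rw [add_assoc]
      exact (key ε hε x hx).2
  · intro h
    exact csInf_le ⟨0, fun d hd => hd.1.le⟩ ⟨hδ, h⟩

/-- The matrix has full column rank, that is, its null space is `{0}`. -/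
def FullColumnRank {k n : ℕ} (A : Matrix (Fin k) (Fin n) ℝ) : Prop :=
  LinearMap.ker A.mulVecLin = ⊥

/-- The matrix `I - A₂ (A₂ᵀ A₂)⁻¹ A₂ᵀ`; if `A₂` has full column rank it is the orthogonal
projection onto the orthogonal complement of the range of `A₂`. -/
noncomputable def rangeComplProj {k r : ℕ} (A₂ : Matrix (Fin k) (Fin r) ℝ) :
    Matrix (Fin k) (Fin k) ℝ :=
  1 - A₂ * (A₂.transpose * A₂)⁻¹ * A₂.transpose

/-- The partial restricted isometry constant of order `t` of `A = (A₁, A₂)`: the restricted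
isometry constant of order `t` of `P A₁`. It is meant for `A₂` of full column rank only. -/
noncomputable def partialRipConstant {k m r : ℕ} (A₁ : Matrix (Fin k) (Fin m) ℝ)
    (A₂ : Matrix (Fin k) (Fin r) ℝ) (t : ℕ) : ℝ :=
  ripConstant (rangeComplProj A₂ * A₁) t

/-- `A = (A₁, A₂)` satisfies the partial restricted isometry property of order `t` with
constant at most `δ`: `A₂` has full column rank and the partial constant is at most `δ`. -/
def HasPartialRIP {k m r : ℕ} (A₁ : Matrix (Fin k) (Fin m) ℝ)
    (A₂ : Matrix (Fin k) (Fin r) ℝ) (t : ℕ) (δ : ℝ) : Prop :=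
  FullColumnRank A₂ ∧ partialRipConstant A₁ A₂ t ≤ δ

/-- The entries of the random matrix `A = (A₁, A₂)` are (jointly) independent centred Gaussian
variables with variance `1 / k`, where `k` is the number of rows. -/
structure IsGaussianMatrix {Ω : Type*} [MeasurableSpace Ω] {k m r : ℕ}
    (A : Ω → Matrix (Fin k) (Fin m ⊕ Fin r) ℝ) (μ : Measure Ω) : Prop where
  hasLaw_entry : ∀ i j, HasLaw (fun ω => A ω i j) (gaussianReal 0 (1 / (k : NNReal))) μ
  indep_entry : iIndepFun (fun (p : Fin k × (Fin m ⊕ Fin r)) ω => A ω p.1 p.2) μ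

/-! The projection is removed first. If `A` satisfies `|‖A v‖² - ‖v‖²| ≤ δ ‖v‖²` for every `v = (x,
w)` with `x` supported on a set of size `t = s - r` and `w` arbitrary, then partial RIP follows
(`hasPartialRIP_of_forall_support`): `P A₁ x` equals `A (x, -w)` for the least-squares `w`, and the
extra `‖w‖²` only helps the lower bound, while `P` is a contraction, which gives the upper bound.

Such `v` form `(N - r).choose t` subspaces of dimension at most `s`. On each one a `1/4`-net of the
unit sphere has at most `9 ^ s` points and determines the quadratic form up to a factor 2
(`abs_normSq_sub_le_of_net`). At a fixed unit vector, `‖A v‖²` is a sum of squares of `k`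
independent Gaussians of variance `1/k`, and the Chernoff bound `sum_sq_gaussian_tails` at deviation
`δ/2` has exponent `k (3δ² - δ³) / 48`. Half of the assumed size of `k` pays for the union bound;
the other half leaves `2 / N`.

For `s = r` the exponent need not grow with `N`. But then only the full rank of `A₂` matters, and it
holds almost surely. -/

/-! ### Law of `A x` for a fixed unit vector `x` -/

theorem pi_map_curry {ι κ E : Type*} [Fintype ι] [Fintype κ] [MeasurableSpace E]
    (ν : Measure E) [IsProbabilityMeasure ν] :
    (Measure.pi (fun _ : ι × κ => ν)).map Function.curry =
      Measure.pi (fun _ : ι => Measure.pi (fun _ : κ => ν)) := by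
  have h := Measure.infinitePi_map_curry (ι := ι) (κ := κ) (X := E) (fun _ _ => ν)
  simp only [Measure.infinitePi_eq_pi] at h
  exact h

theorem map_sum_mul_gaussianReal {Ω ι : Type*} [MeasurableSpace Ω] [Fintype ι] {μ : Measure Ω}
    {X : ι → Ω → ℝ} {v : NNReal} (hX : ∀ i, HasLaw (X i) (gaussianReal 0 v) μ)
    (hind : iIndepFun X μ) (x : ι → ℝ) (hx : ∑ i, x i ^ 2 = 1) :
    HasLaw (fun ω => ∑ i, X i ω * x i) (gaussianReal 0 v) μ := by
  have hlaw (i : ι) : HasLaw (fun ω => X i ω * x i)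
      (gaussianReal (0 * x i) (NNReal.mk (x i ^ 2) (sq_nonneg _) * v)) μ := by
    simpa [mul_comm] using gaussianReal_mul_const (hX i) (x i)
  have hind' : iIndepFun (fun i ω => X i ω * x i) μ :=
    hind.comp (fun i y => y * x i) (fun i => by fun_prop)
  have := hind.isProbabilityMeasure
  refine ⟨Finset.aemeasurable_fun_sum _ fun i _ => (hlaw i).aemeasurable, ?_⟩
  have hm : AEMeasurable (fun ω => ∑ i, X i ω * x i) μ :=
    Finset.aemeasurable_fun_sum _ fun i _ => (hlaw i).aemeasurable
  have := Measure.isProbabilityMeasure_map hm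
  refine Measure.ext_of_charFun ?_
  rw [hind'.charFun_map_fun_sum_eq_prod (fun i => (hlaw i).aemeasurable)]
  ext t
  simp only [(hlaw _).map_eq, Finset.prod_apply, charFun_gaussianReal]
  rw [← Complex.exp_sum]
  congr 1
  have hx' : ∑ i, (x i : ℂ) ^ 2 = 1 := by exact_mod_cast hx
  simp only [zero_mul, Complex.ofReal_zero, mul_zero, zero_sub, Finset.sum_neg_distrib,
    NNReal.coe_mul, NNReal.coe_mk, Complex.ofReal_mul, Complex.ofReal_pow]
  rw [← Finset.sum_div, ← Finset.sum_mul, ← Finset.sum_mul, hx', one_mul]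

/-- Currying turns the product law of all entries into the product of the row laws. -/
theorem IsGaussianMatrix.iIndepFun_rows {Ω : Type*} [MeasurableSpace Ω] {k m r : ℕ}
    {A : Ω → Matrix (Fin k) (Fin m ⊕ Fin r) ℝ} {μ : Measure Ω} (h : IsGaussianMatrix A μ) :
    iIndepFun (fun i ω => A ω i) μ := by
  have := h.indep_entry.isProbabilityMeasure
  have hm (i) : AEMeasurable (fun ω => A ω i) μ :=
    aemeasurable_pi_lambda _ fun j => (h.hasLaw_entry i j).aemeasurable
  have hp : AEMeasurable (fun ω (p : Fin k × (Fin m ⊕ Fin r)) => A ω p.1 p.2) μ :=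
    aemeasurable_pi_lambda _ fun p => (h.hasLaw_entry p.1 p.2).aemeasurable
  rw [iIndepFun_iff_map_fun_eq_pi_map hm]
  have h1 : μ.map (fun ω (p : Fin k × (Fin m ⊕ Fin r)) => A ω p.1 p.2) =
      Measure.pi (fun _ => gaussianReal 0 (1 / (k : NNReal))) := by
    have := h.indep_entry.map_fun_eq_pi_map
      fun p : Fin k × (Fin m ⊕ Fin r) => (h.hasLaw_entry p.1 p.2).aemeasurable
    simp only [(h.hasLaw_entry _ _).map_eq] at this
    exact this
  have h2 (i) : μ.map (fun ω => A ω i) =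
      Measure.pi (fun _ => gaussianReal 0 (1 / (k : NNReal))) := by
    have hi : iIndepFun (fun j ω => A ω i j) μ :=
      h.indep_entry.precomp (g := fun j => (i, j)) (fun _ _ hab => (Prod.ext_iff.1 hab).2)
    have := hi.map_fun_eq_pi_map fun j => (h.hasLaw_entry i j).aemeasurable
    simp only [(h.hasLaw_entry _ _).map_eq] at this
    exact this
  simp only [h2]
  rw [← pi_map_curry, ← h1, AEMeasurable.map_map_of_aemeasurable]
  · rfl
  · exact Measurable.aemeasurable (by unfold Function.curry; fun_prop)
  · exact hp

theorem IsGaussianMatrix.hasLaw_mulVec {Ω : Type*} [MeasurableSpace Ω] {k m r : ℕ}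
    {A : Ω → Matrix (Fin k) (Fin m ⊕ Fin r) ℝ} {μ : Measure Ω} (h : IsGaussianMatrix A μ)
    {x : Fin m ⊕ Fin r → ℝ} (hx : ∑ i, x i ^ 2 = 1) (i : Fin k) :
    HasLaw (fun ω => (A ω).mulVec x i) (gaussianReal 0 (1 / (k : NNReal))) μ :=
  map_sum_mul_gaussianReal (h.hasLaw_entry i)
    (h.indep_entry.precomp (g := fun j => (i, j)) (fun _ _ hab => (Prod.ext_iff.1 hab).2)) x hx

theorem IsGaussianMatrix.iIndepFun_mulVec {Ω : Type*} [MeasurableSpace Ω] {k m r : ℕ}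
    {A : Ω → Matrix (Fin k) (Fin m ⊕ Fin r) ℝ} {μ : Measure Ω} (h : IsGaussianMatrix A μ)
    (x : Fin m ⊕ Fin r → ℝ) : iIndepFun (fun i ω => (A ω).mulVec x i) μ :=
  h.iIndepFun_rows.comp (fun _ a => ∑ j, a j * x j) (fun _ => by fun_prop)

/-! ### Chernoff bounds for sums of Gaussian squares -/

theorem exp_mul_sq_gaussianPDFReal (v : NNReal) (hv : v ≠ 0) (t x : ℝ) :
    gaussianPDFReal 0 v x * Real.exp (t * x ^ 2) =
      (√(2 * Real.pi * v))⁻¹ * Real.exp (-((1 - 2 * t * v) / (2 * v)) * x ^ 2) := by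
  have hv' : (v : ℝ) ≠ 0 := by exact_mod_cast hv
  rw [gaussianPDFReal, mul_assoc, ← Real.exp_add]
  congr 2
  field_simp
  ring

theorem integrable_exp_mul_sq_gaussianReal {v : NNReal} (hv : v ≠ 0) {t : ℝ}
    (ht : 2 * t * v < 1) :
    Integrable (fun x => Real.exp (t * x ^ 2)) (gaussianReal 0 v) := by
  have hv' : (0 : ℝ) < v := by exact_mod_cast pos_iff_ne_zero.2 hv
  rw [gaussianReal_of_var_ne_zero _ hv,
    integrable_withDensity_iff_integrable_smul₀' (by fun_prop) (by simp [gaussianPDF_lt_top])]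
  simp only [toReal_gaussianPDF, smul_eq_mul, exp_mul_sq_gaussianPDFReal v hv]
  exact (integrable_exp_neg_mul_sq (div_pos (by linarith) (by positivity))).const_mul _

theorem mgf_sq_gaussianReal {v : NNReal} (hv : v ≠ 0) {t : ℝ} (ht : 2 * t * v < 1) :
    mgf (fun x => x ^ 2) (gaussianReal 0 v) t = (√(1 - 2 * t * v))⁻¹ := by
  have hv' : (0 : ℝ) < v := by exact_mod_cast pos_iff_ne_zero.2 hv
  rw [mgf, integral_gaussianReal_eq_integral_smul hv]
  simp only [smul_eq_mul, exp_mul_sq_gaussianPDFReal v hv]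
  have h1 : 0 < 1 - 2 * t * v := by linarith
  rw [integral_const_mul, integral_gaussian, ← Real.sqrt_inv, ← Real.sqrt_mul (by positivity),
    ← Real.sqrt_inv]
  congr 1
  have := Real.pi_pos
  field_simp

/-- The difference of the two sides vanishes at `0` and has derivative `x ^ 3 / (1 + x)`, which has
the sign of `x`. Both signs of `u` are needed, one for each tail. -/
theorem log_one_add_le {u : ℝ} (hu : -1 < u) :
    Real.log (1 + u) ≤ u - u ^ 2 / 2 + u ^ 3 / 3 := by
  let f : ℝ → ℝ := fun u => u - u ^ 2 / 2 + u ^ 3 / 3 - Real.log (1 + u)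
  have hd (x : ℝ) (hx : -1 < x) : HasDerivAt f (x ^ 3 / (1 + x)) x := by
    have h1 : HasDerivAt (fun u : ℝ => Real.log (1 + u)) (1 / (1 + x)) x :=
      ((hasDerivAt_id x).const_add 1).log (by simp; linarith)
    have h2 := (((hasDerivAt_id x).sub ((hasDerivAt_pow 2 x).div_const 2)).add
      ((hasDerivAt_pow 3 x).div_const 3)).sub h1
    refine h2.congr_deriv ?_
    have : 1 + x ≠ 0 := by linarith
    field_simp
    norm_num
    ring
  have h0 : f 0 = 0 := by simp [f]
  suffices 0 ≤ f u by simp only [f] at this; linarith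
  have hc (s : Set ℝ) (hs : ∀ x ∈ s, -1 < x) : ContinuousOn f s :=
    fun x hx => (hd x (hs x hx)).continuousAt.continuousWithinAt
  rcases le_total 0 u with h | h
  · rw [← h0]
    refine monotoneOn_of_deriv_nonneg (convex_Icc 0 u) (hc _ fun x hx => by linarith [hx.1])
      ?_ ?_ (Set.left_mem_Icc.2 h) (Set.right_mem_Icc.2 h) h
    · rw [interior_Icc]
      exact fun x hx => (hd x (by linarith [hx.1])).differentiableAt.differentiableWithinAt
    · rw [interior_Icc]
      intro x hx
      rw [(hd x (by linarith [hx.1])).deriv]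
      have := hx.1
      positivity
  · rw [← h0]
    refine antitoneOn_of_deriv_nonpos (convex_Icc u 0) (hc _ fun x hx => by linarith [hx.1])
      ?_ ?_ (Set.left_mem_Icc.2 h) (Set.right_mem_Icc.2 h) h
    · rw [interior_Icc]
      exact fun x hx => (hd x (by linarith [hx.1])).differentiableAt.differentiableWithinAt
    · rw [interior_Icc]
      intro x hx
      rw [(hd x (by linarith [hx.1])).deriv]
      refine div_nonpos_of_nonpos_of_nonneg ?_ (by linarith [hx.1])
      exact (Odd.pow_nonpos_iff (by decide)).2 hx.2.le

/-- The moment generating function of the sum of the squares of `k` independent centred Gaussian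
variables of variance `1 / k`, at the point relevant to the Chernoff bound at `1 + u`. -/
theorem mgf_sum_sq_gaussian {Ω : Type*} [MeasurableSpace Ω] {μ : Measure Ω} {k : ℕ} (hk : 0 < k)
    {Y : Fin k → Ω → ℝ} (hY : ∀ i, HasLaw (Y i) (gaussianReal 0 (1 / (k : NNReal))) μ)
    (hind : iIndepFun Y μ) {u : ℝ} (hu : -1 < u) :
    Integrable (fun ω => Real.exp (k * u / (2 * (1 + u)) * ∑ i, Y i ω ^ 2)) μ ∧
    mgf (fun ω => ∑ i, Y i ω ^ 2) μ (k * u / (2 * (1 + u))) =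
      Real.exp (k / 2 * Real.log (1 + u)) := by
  have := hind.isProbabilityMeasure
  set t := k * u / (2 * (1 + u)) with ht
  have hk' : (0 : ℝ) < k := by exact_mod_cast hk
  have hv : 1 / (k : NNReal) ≠ 0 := by positivity
  have h1 : 0 < 1 + u := by linarith
  have hv2 : 1 - 2 * t * (1 / (k : NNReal) : NNReal) = (1 + u)⁻¹ := by
    push_cast
    rw [ht]
    field_simp
    ring
  have htv : 2 * t * (1 / (k : NNReal) : NNReal) < 1 := by
    have : 0 < (1 + u)⁻¹ := by positivity
    linarith
  have hind2 : iIndepFun (fun i ω => Y i ω ^ 2) μ :=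
    hind.comp (fun _ y => y ^ 2) (fun _ => by fun_prop)
  have hm (i) : AEMeasurable (fun ω => Y i ω ^ 2) μ := (hY i).aemeasurable.pow_const 2
  have hmgf (i) : mgf (fun ω => Y i ω ^ 2) μ t = √(1 + u) := by
    have h2 := mgf_sq_gaussianReal hv htv
    rw [hv2, Real.sqrt_inv, inv_inv, ← (hY i).map_eq, mgf, integral_map (hY i).aemeasurable
      (Measurable.aestronglyMeasurable (by fun_prop))] at h2
    exact h2
  have hint (i) : Integrable (fun ω => Real.exp (t * Y i ω ^ 2)) μ := by
    have := integrable_exp_mul_sq_gaussianReal hv htv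
    rw [← (hY i).map_eq] at this
    exact this.comp_aemeasurable (hY i).aemeasurable
  have hsum : (fun ω => ∑ i, Y i ω ^ 2) = ∑ i, fun ω => Y i ω ^ 2 := by
    ext ω; simp
  have hM : mgf (fun ω => ∑ i, Y i ω ^ 2) μ t = Real.exp (k / 2 * Real.log (1 + u)) := by
    rw [hsum, hind2.mgf_sum₀ hm]
    simp only [hmgf, Finset.prod_const, Finset.card_univ, Fintype.card_fin]
    rw [Real.sqrt_eq_rpow, ← Real.rpow_natCast, ← Real.rpow_mul h1.le, Real.rpow_def_of_pos h1]
    congr 1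
    ring
  refine ⟨?_, hM⟩
  -- A non-integrable exponential would make the mgf take the default value `0`, but it was computed
  -- to be positive.
  by_contra hcon
  have : mgf (fun ω => ∑ i, Y i ω ^ 2) μ t = 0 := integral_undef hcon
  rw [hM] at this
  exact (Real.exp_pos _).ne' this

theorem sum_sq_gaussian_tails {Ω : Type*} [MeasurableSpace Ω] {μ : Measure Ω} {k : ℕ} (hk : 0 < k)
    {Y : Fin k → Ω → ℝ} (hY : ∀ i, HasLaw (Y i) (gaussianReal 0 (1 / (k : NNReal))) μ)
    (hind : iIndepFun Y μ) {ε : ℝ} (hε : 0 < ε) (hε1 : ε < 1) :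
    μ.real {ω | ε ≤ |∑ i, Y i ω ^ 2 - 1|} ≤ 2 * Real.exp (-(k * (ε ^ 2 / 4 - ε ^ 3 / 6))) := by
  have := hind.isProbabilityMeasure
  have hk' : (0 : ℝ) < k := by exact_mod_cast hk
  -- One estimate covers both tails, with `u = ε` and `u = -ε`; the lower tail is in fact smaller,
  -- and its better cubic term is given away.
  have key (u : ℝ) (hu : -1 < u) (hu' : u ^ 3 ≤ ε ^ 3) (hu2 : u ^ 2 = ε ^ 2) :
      Real.exp (-(k * u / (2 * (1 + u))) * (1 + u)) *
        mgf (fun ω => ∑ i, Y i ω ^ 2) μ (k * u / (2 * (1 + u))) ≤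
      Real.exp (-(k * (ε ^ 2 / 4 - ε ^ 3 / 6))) := by
    rw [(mgf_sum_sq_gaussian hk hY hind hu).2, ← Real.exp_add]
    apply Real.exp_le_exp.2
    have h1 : -(k * u / (2 * (1 + u))) * (1 + u) = -(k / 2 * u) := by
      have : 1 + u ≠ 0 := by linarith
      field_simp
    rw [h1]
    have h2 := log_one_add_le hu
    have h3 : Real.log (1 + u) ≤ u - ε ^ 2 / 2 + ε ^ 3 / 3 := by rw [hu2] at h2; linarith
    have := mul_le_mul_of_nonneg_left h3 (by positivity : (0 : ℝ) ≤ k / 2)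
    linarith
  have hup := (measure_ge_le_exp_mul_mgf (1 + ε) (by positivity)
    (mgf_sum_sq_gaussian hk hY hind (u := ε) (by linarith)).1).trans
      (key ε (by linarith) le_rfl rfl)
  have hlo := (measure_le_le_exp_mul_mgf (1 + -ε)
    (div_nonpos_of_nonpos_of_nonneg (by nlinarith) (by linarith))
    (mgf_sum_sq_gaussian hk hY hind (u := -ε) (by linarith)).1).trans
      (key (-ε) (by linarith) (by have := pow_pos hε 3; ring_nf; linarith) (by ring))
  calc μ.real {ω | ε ≤ |∑ i, Y i ω ^ 2 - 1|}
      ≤ μ.real ({ω | 1 + ε ≤ ∑ i, Y i ω ^ 2} ∪ {ω | ∑ i, Y i ω ^ 2 ≤ 1 + -ε}) := by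
        refine measureReal_mono fun ω hω => ?_
        rcases le_abs.1 (show ε ≤ |∑ i, Y i ω ^ 2 - 1| from hω) with h | h
        · exact Or.inl (show 1 + ε ≤ _ by linarith)
        · exact Or.inr (show _ ≤ 1 + -ε by linarith)
    _ ≤ _ := measureReal_union_le _ _
    _ ≤ _ := by linarith

theorem IsGaussianMatrix.measureReal_mulVec_sq_le {Ω : Type*} [MeasurableSpace Ω] {k m r : ℕ}
    {A : Ω → Matrix (Fin k) (Fin m ⊕ Fin r) ℝ} {μ : Measure Ω} (h : IsGaussianMatrix A μ)
    (hk : 0 < k) {x : Fin m ⊕ Fin r → ℝ} (hx : ∑ i, x i ^ 2 = 1) {ε : ℝ} (hε : 0 < ε)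
    (hε1 : ε < 1) :
    μ.real {ω | ε ≤ |∑ i, (A ω).mulVec x i ^ 2 - 1|} ≤
      2 * Real.exp (-(k * (ε ^ 2 / 4 - ε ^ 3 / 6))) :=
  sum_sq_gaussian_tails hk (h.hasLaw_mulVec hx) (h.iIndepFun_mulVec x) hε hε1

/-! ### Almost sure full column rank -/

theorem pi_absolutelyContinuous {ι : Type*} [Fintype ι] {ν ρ : Measure ℝ} [SigmaFinite ν]
    [SigmaFinite ρ] (h : ν ≪ ρ) :
    Measure.pi (fun _ : ι => ν) ≪ Measure.pi (fun _ : ι => ρ) := by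
  refine Fintype.induction_empty_option
    (P := fun ι _ => Measure.pi (fun _ : ι => ν) ≪ Measure.pi (fun _ : ι => ρ)) ?_ ?_ ?_ ι
  · intro α β _ e ih
    let _ : Fintype α := Fintype.ofEquiv β e.symm
    rw [← (measurePreserving_piCongrLeft (fun _ : β => ν) e).map_eq,
      ← (measurePreserving_piCongrLeft (fun _ : β => ρ) e).map_eq]
    exact ih.map (MeasurableEquiv.measurable _)
  · rw [Measure.pi_of_empty, Measure.pi_of_empty]
  · intro α _ ih
    rw [← Measure.pi_map_piOptionEquivProd, ← Measure.pi_map_piOptionEquivProd]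
    exact (ih.prod h).map (MeasurableEquiv.measurable _)

/-- Almost every square block of a matrix is invertible. -/
theorem ae_det_submatrix_ne_zero {k r : ℕ} (h : r ≤ k) :
    ∀ᵐ y : Fin k × Fin r → ℝ,
      (Matrix.of fun i j : Fin r => y (Fin.castLE h i, j)).det ≠ 0 := by
  -- The direction is the identity matrix padded by zero rows. Along any line in this direction the
  -- determinant is a characteristic polynomial in `t`, with finitely many roots, so the exceptional
  -- set meets each line in a null set.
  let L : ℝ →ₗ[ℝ] (Fin k × Fin r → ℝ) :=
    LinearMap.toSpanSingleton ℝ _ (fun p => if (p.1 : ℕ) = p.2 then 1 else 0)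
  let s : Set (Fin k × Fin r → ℝ) :=
    {y | (Matrix.of fun i j : Fin r => y (Fin.castLE h i, j)).det ≠ 0}
  have hs : MeasurableSet s := by
    have hc : Continuous fun y : Fin k × Fin r → ℝ =>
        (Matrix.of fun i j : Fin r => y (Fin.castLE h i, j)).det :=
      Continuous.matrix_det (continuous_matrix fun i j => continuous_apply _)
    exact (isOpen_ne.preimage hc).measurableSet
  refine ae_mem_of_ae_add_linearMap_mem L volume volume hs fun y => ?_
  let M : Matrix (Fin r) (Fin r) ℝ := Matrix.of fun i j => y (Fin.castLE h i, j)
  have hdet (t : ℝ) : (Matrix.of fun i j : Fin r => (y + L t) (Fin.castLE h i, j)).det =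
      (-M).charpoly.eval t := by
    rw [Matrix.eval_charpoly]
    congr 1
    ext i j
    by_cases hij : i = j
    · subst hij
      simp [L, M, add_comm]
    · have : (i : ℕ) ≠ j := fun h => hij (Fin.ext h)
      simp [L, M, hij, this]
  have hfin : {t : ℝ | y + L t ∉ s}.Finite := by
    refine ((-M).charpoly.roots.toFinset.finite_toSet).subset fun t ht => ?_
    have ht' : (-M).charpoly.eval t = 0 := by
      rw [← hdet]
      by_contra hne
      exact ht hne
    simp [(Matrix.charpoly_monic _).ne_zero, ht']
  exact hfin.measure_zero volume

theorem fullColumnRank_of_det_ne_zero {k r : ℕ} (h : r ≤ k) (A : Matrix (Fin k) (Fin r) ℝ)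
    (hA : (Matrix.of fun i j : Fin r => A (Fin.castLE h i) j).det ≠ 0) : FullColumnRank A := by
  rw [FullColumnRank, LinearMap.ker_eq_bot']
  intro w hw
  refine Matrix.eq_zero_of_mulVec_eq_zero hA ?_
  ext i
  exact congrFun hw (Fin.castLE h i)

theorem IsGaussianMatrix.ae_fullColumnRank {Ω : Type*} [MeasurableSpace Ω] {k m r : ℕ}
    {A : Ω → Matrix (Fin k) (Fin m ⊕ Fin r) ℝ} {μ : Measure Ω} (h : IsGaussianMatrix A μ)
    (hk : 0 < k) (hr : r ≤ k) : ∀ᵐ ω ∂μ, FullColumnRank (A ω).toCols₂ := by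
  have hind : iIndepFun (fun (p : Fin k × Fin r) ω => A ω p.1 (Sum.inr p.2)) μ :=
    h.indep_entry.precomp (g := fun p : Fin k × Fin r => (p.1, Sum.inr p.2))
      (fun a b hab => by simpa [Prod.ext_iff] using hab)
  have hmap := hind.map_fun_eq_pi_map
    fun p : Fin k × Fin r => (h.hasLaw_entry p.1 (Sum.inr p.2)).aemeasurable
  simp only [(h.hasLaw_entry _ _).map_eq] at hmap
  have hac := pi_absolutelyContinuous (ι := Fin k × Fin r)
    (gaussianReal_absolutelyContinuous 0
    (show 1 / (k : NNReal) ≠ 0 by positivity))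
  rw [← hmap] at hac
  have hm : AEMeasurable (fun ω (p : Fin k × Fin r) => A ω p.1 (Sum.inr p.2)) μ :=
    aemeasurable_pi_lambda _ fun p => (h.hasLaw_entry p.1 (Sum.inr p.2)).aemeasurable
  filter_upwards [ae_of_ae_map hm (hac.ae_le (ae_det_submatrix_ne_zero hr))] with ω hω
  exact fullColumnRank_of_det_ne_zero hr _ hω

/-! ### Nets on the unit sphere -/

/-- Volume comparison: the balls of radius `1/8` around the points are disjoint and lie in the ball
of radius `9/8`. -/
theorem card_le_of_quarter_separated {E : Type*} [NormedAddCommGroup E] [NormedSpace ℝ E]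
    [FiniteDimensional ℝ E] (s : Finset E) (hs : ∀ c ∈ s, ‖c‖ = 1)
    (h : ∀ c ∈ s, ∀ d ∈ s, c ≠ d → 1 / 4 ≤ ‖c - d‖) : s.card ≤ 9 ^ Module.finrank ℝ E := by
  borelize E
  let μ : Measure E := Measure.addHaar
  have hdisj : (s : Set E).PairwiseDisjoint fun c => Metric.ball c (1 / 8) := by
    rintro c hc d hd hcd
    apply Metric.ball_disjoint_ball
    rw [dist_eq_norm]
    have := h c hc d hd hcd
    linarith
  have hsub : (⋃ c ∈ s, Metric.ball c (1 / 8)) ⊆ Metric.ball (0 : E) (9 / 8) := by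
    refine Set.iUnion₂_subset fun x hx => ?_
    apply Metric.ball_subset_ball'
    rw [dist_zero_right, hs x hx]
    norm_num
  have hI : (s.card : ENNReal) * ENNReal.ofReal ((1 / 8) ^ Module.finrank ℝ E) *
      μ (Metric.ball 0 1) ≤
        ENNReal.ofReal ((9 / 8) ^ Module.finrank ℝ E) * μ (Metric.ball 0 1) := by
    have := measure_mono (μ := μ) hsub
    rw [measure_biUnion_finset hdisj fun c _ => measurableSet_ball] at this
    simpa only [μ.addHaar_ball_of_pos _ (show (0 : ℝ) < 1 / 8 by norm_num),
      μ.addHaar_ball_of_pos _ (show (0 : ℝ) < 9 / 8 by norm_num), Finset.sum_const,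
      nsmul_eq_mul, mul_assoc] using this
  have hJ := (ENNReal.mul_le_mul_iff_left (Metric.measure_ball_pos _ _ zero_lt_one).ne'
    measure_ball_lt_top.ne).1 hI
  have hK : (s.card : ℝ) ≤ (9 : ℝ) ^ Module.finrank ℝ E := by
    have := ENNReal.toReal_le_of_le_ofReal (by positivity) hJ
    simpa [div_eq_mul_inv, mul_pow] using this
  exact_mod_cast hK

/-- The unit sphere of a `d`-dimensional space has a `1 / 4`-net of at most `9 ^ d` points. -/
theorem exists_quarter_net (E : Type*) [NormedAddCommGroup E] [NormedSpace ℝ E]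
    [FiniteDimensional ℝ E] :
    ∃ s : Finset E, s.card ≤ 9 ^ Module.finrank ℝ E ∧ (∀ c ∈ s, ‖c‖ = 1) ∧
      ∀ x : E, ‖x‖ = 1 → ∃ c ∈ s, ‖x - c‖ ≤ 1 / 4 := by
  classical
  -- A separated set of maximal cardinality is a net: a point far from all of it could be added.
  let P : ℕ → Prop := fun n => ∃ s : Finset E, s.card = n ∧ (∀ c ∈ s, ‖c‖ = 1) ∧
    ∀ c ∈ s, ∀ d ∈ s, c ≠ d → 1 / 4 ≤ ‖c - d‖
  have hP0 : P 0 := ⟨∅, by simp, by simp, by simp⟩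
  have hb : ∀ n, P n → n ≤ 9 ^ Module.finrank ℝ E := by
    rintro _ ⟨s, rfl, h1, h2⟩
    exact card_le_of_quarter_separated s h1 h2
  obtain ⟨s, hcard, h1, h2⟩ := Nat.findGreatest_spec (P := P) (Nat.zero_le _) hP0
  refine ⟨s, card_le_of_quarter_separated s h1 h2, h1, fun x hx => ?_⟩
  by_contra! hcon
  have hxs : x ∉ s := fun hmem => by
    have := hcon x hmem
    norm_num at this
  have hP : P (s.card + 1) := by
    refine ⟨insert x s, Finset.card_insert_of_notMem hxs, ?_, ?_⟩
    · intro c hc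
      rcases Finset.mem_insert.1 hc with rfl | hc
      · exact hx
      · exact h1 c hc
    · intro c hc d hd hcd
      rcases Finset.mem_insert.1 hc with rfl | hc' <;> rcases Finset.mem_insert.1 hd with rfl | hd'
      · exact absurd rfl hcd
      · exact (hcon d hd').le
      · rw [norm_sub_rev]; exact (hcon c hc').le
      · exact h2 c hc' d hd' hcd
  exact absurd ((Nat.le_findGreatest (hb _ hP) hP).trans hcard.ge) (Nat.not_succ_le_self _)

/-- A bound of the quadratic form `‖T x‖² - ‖x‖²` on a `1 / 4`-net of the unit sphere gives twice
that bound on the whole space. -/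
theorem abs_normSq_sub_le_of_net {E F : Type*} [NormedAddCommGroup E] [InnerProductSpace ℝ E]
    [FiniteDimensional ℝ E] [NormedAddCommGroup F] [InnerProductSpace ℝ F] (T : E →ₗ[ℝ] F)
    {s : Set E} (hs : ∀ c ∈ s, ‖c‖ = 1) (hnet : ∀ x : E, ‖x‖ = 1 → ∃ c ∈ s, ‖x - c‖ ≤ 1 / 4)
    {δ : ℝ} (hδ : ∀ c ∈ s, |‖T c‖ ^ 2 - 1| ≤ δ / 2) (x : E) :
    |‖T x‖ ^ 2 - ‖x‖ ^ 2| ≤ δ * ‖x‖ ^ 2 := by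
  rcases subsingleton_or_nontrivial E with hE | hE
  · rw [Subsingleton.elim x 0]; simp
  let Q : E → ℝ := fun x => ‖T x‖ ^ 2 - ‖x‖ ^ 2
  have hQc : Continuous Q := by
    have : Continuous T := T.continuous_of_finiteDimensional
    fun_prop
  have hQs (a : ℝ) (x : E) : Q (a • x) = a ^ 2 * Q x := by
    simp only [Q, map_smul, norm_smul, mul_pow, Real.norm_eq_abs, sq_abs]
    ring
  obtain ⟨z, hz, hmax⟩ := (isCompact_sphere (0 : E) 1).exists_isMaxOn
    (NormedSpace.sphere_nonempty.2 zero_le_one) hQc.abs.continuousOn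
  have hz1 : ‖z‖ = 1 := by simpa using hz
  set M := |Q z| with hM
  have hM0 : 0 ≤ M := abs_nonneg _
  have hQM (x : E) : |Q x| ≤ M * ‖x‖ ^ 2 := by
    rcases eq_or_ne x 0 with rfl | hx
    · simp [Q]
    have hn : ‖x‖ ≠ 0 := norm_ne_zero_iff.2 hx
    have h1 : ‖(‖x‖⁻¹ • x)‖ = 1 := by rw [norm_smul]; simp [hn]
    have h2 : |Q (‖x‖⁻¹ • x)| ≤ M := hmax (by simpa using h1)
    have h3 : Q x = ‖x‖ ^ 2 * Q (‖x‖⁻¹ • x) := by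
      rw [← hQs, smul_smul, mul_inv_cancel₀ hn, one_smul]
    rw [h3, abs_mul, abs_of_nonneg (sq_nonneg _), mul_comm]
    exact mul_le_mul_of_nonneg_right h2 (sq_nonneg _)
  have hpolar (x y : E) : Q (x + y) - Q (x - y) =
      4 * (inner ℝ (T x) (T y) - inner ℝ x y) := by
    simp only [Q, map_add, map_sub, norm_add_sq_real, norm_sub_sq_real]
    ring
  have hQd (x y : E) : Q x - Q y = inner ℝ (T (x - y)) (T (x + y)) - inner ℝ (x - y) (x + y) := by
    simp only [Q, map_add, map_sub, inner_add_right, inner_sub_left,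
      real_inner_self_eq_norm_sq, real_inner_comm]
    ring
  have hbil (x y : E) : |inner ℝ (T x) (T y) - inner ℝ x y| ≤ M / 2 * (‖x‖ ^ 2 + ‖y‖ ^ 2) := by
    have h1 := hpolar x y
    have h2 := hQM (x + y)
    have h3 := hQM (x - y)
    have h4 := parallelogram_law_with_norm ℝ x y
    have h5 : M * ‖x + y‖ ^ 2 + M * ‖x - y‖ ^ 2 = 2 * M * (‖x‖ ^ 2 + ‖y‖ ^ 2) := by
      linear_combination M * h4
    rw [abs_le] at h2 h3 ⊢
    constructor <;> linarith [h2.1, h2.2, h3.1, h3.2]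
  have hMδ : M ≤ δ := by
    obtain ⟨c, hc, hzc⟩ := hnet z hz1
    have hc1 := hs c hc
    have h1 : |Q c| ≤ δ / 2 := by simpa [Q, hc1] using hδ c hc
    -- `Q z - Q c` is the bilinear form at `z - c` and `z + c`. The factors `4` and `1/2` bring both
    -- vectors into the unit ball, so `2 |Q z - Q c| ≤ M`; hence `M ≤ M / 2 + δ / 2`.
    have h2 := hbil ((4 : ℝ) • (z - c)) ((1 / 2 : ℝ) • (z + c))
    have h3 : inner ℝ (T ((4 : ℝ) • (z - c))) (T ((1 / 2 : ℝ) • (z + c))) -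
        inner ℝ ((4 : ℝ) • (z - c)) ((1 / 2 : ℝ) • (z + c)) = 2 * (Q z - Q c) := by
      rw [hQd]
      simp only [map_smul, inner_smul_left, inner_smul_right]
      simp
      ring
    have h4 : ‖(4 : ℝ) • (z - c)‖ ≤ 1 := by
      rw [norm_smul]; norm_num; linarith
    have h5 : ‖(1 / 2 : ℝ) • (z + c)‖ ≤ 1 := by
      rw [norm_smul]; norm_num; linarith [norm_add_le z c]
    rw [h3] at h2
    have h6 : ‖(4 : ℝ) • (z - c)‖ ^ 2 ≤ 1 := pow_le_one₀ (norm_nonneg _) h4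
    have h7 : ‖(1 / 2 : ℝ) • (z + c)‖ ^ 2 ≤ 1 := pow_le_one₀ (norm_nonneg _) h5
    have h8 : |2 * (Q z - Q c)| ≤ M := h2.trans (by nlinarith)
    rw [abs_mul, abs_two] at h8
    have h9 : M ≤ |Q z - Q c| + |Q c| := by
      have := abs_add_le (Q z - Q c) (Q c)
      simpa using this
    linarith
  exact (hQM x).trans (mul_le_mul_of_nonneg_right hMδ (sq_nonneg _))

/-! ### Reduction of partial RIP to near-isometry on coordinate subspaces -/

theorem norm_sq_toEuclideanLin {k n : ℕ} (A : Matrix (Fin k) (Fin n) ℝ)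
    (x : EuclideanSpace ℝ (Fin n)) :
    ‖Matrix.toEuclideanLin A x‖ ^ 2 = ∑ i, (A.mulVec x.ofLp) i ^ 2 := by
  rw [EuclideanSpace.real_norm_sq_eq]
  rfl

theorem isUnit_det_gram {k r : ℕ} {A₂ : Matrix (Fin k) (Fin r) ℝ} (h : FullColumnRank A₂) :
    IsUnit (A₂.transpose * A₂).det := by
  rw [isUnit_iff_ne_zero]
  intro h0
  obtain ⟨w, hw0, hw⟩ := Matrix.exists_mulVec_eq_zero_iff.2 h0
  apply hw0
  have h1 : A₂.mulVec w ⬝ᵥ A₂.mulVec w = 0 := by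
    rw [Matrix.dotProduct_mulVec, ← Matrix.mulVec_transpose, Matrix.mulVec_mulVec, hw]
    simp
  have h2 : A₂.mulVec w = 0 := dotProduct_self_eq_zero.1 h1
  exact (LinearMap.ker_eq_bot'.1 h) w h2

/-- `y` decomposes as `P y + A₂ w` with orthogonal summands. -/
theorem exists_rangeComplProj_decomp {k r : ℕ} {A₂ : Matrix (Fin k) (Fin r) ℝ}
    (h : FullColumnRank A₂) (y : Fin k → ℝ) :
    ∃ w : Fin r → ℝ, (rangeComplProj A₂).mulVec y = y - A₂.mulVec w ∧
      ∑ i, (rangeComplProj A₂).mulVec y i ^ 2 ≤ ∑ i, y i ^ 2 := by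
  set G := A₂.transpose * A₂ with hG
  have hdet : IsUnit G.det := isUnit_det_gram h
  set w := (G⁻¹ * A₂.transpose).mulVec y with hw
  set p := (rangeComplProj A₂).mulVec y with hp
  have h1 : p = y - A₂.mulVec w := by
    rw [hp, rangeComplProj, Matrix.sub_mulVec, Matrix.one_mulVec, hw, Matrix.mulVec_mulVec,
      Matrix.mul_assoc]
  refine ⟨w, h1, ?_⟩
  -- The normal equations: the residual `p` is orthogonal to the range of `A₂`.
  have h2 : A₂.transpose.mulVec p = 0 := by
    rw [h1, Matrix.mulVec_sub, Matrix.mulVec_mulVec, hw, Matrix.mulVec_mulVec, ← Matrix.mul_assoc,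
      Matrix.mul_nonsing_inv _ hdet, Matrix.one_mul, sub_self]
  have h3 : p ⬝ᵥ A₂.mulVec w = 0 := by
    rw [Matrix.dotProduct_mulVec, ← Matrix.mulVec_transpose, h2, zero_dotProduct]
  have h4 : ∑ i, y i ^ 2 = ∑ i, p i ^ 2 + 2 * (p ⬝ᵥ A₂.mulVec w) +
      ∑ i, (A₂.mulVec w) i ^ 2 := by
    have : ∀ i, y i = p i + A₂.mulVec w i := fun i => by rw [h1]; simp
    rw [dotProduct, Finset.mul_sum, ← Finset.sum_add_distrib, ← Finset.sum_add_distrib]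
    refine Finset.sum_congr rfl fun i _ => ?_
    rw [this i]
    ring
  rw [h4, h3]
  have : 0 ≤ ∑ i, (A₂.mulVec w) i ^ 2 := Finset.sum_nonneg fun i _ => sq_nonneg _
  linarith

theorem hasPartialRIP_of_forall_support {k m r t : ℕ} (A : Matrix (Fin k) (Fin m ⊕ Fin r) ℝ)
    (ht : t ≤ m) {δ : ℝ} (hδ : 0 < δ) (hδ1 : δ < 1)
    (h : ∀ S ∈ Finset.powersetCard t (Finset.univ : Finset (Fin m)),
      ∀ v : Fin m ⊕ Fin r → ℝ, (∀ j ∉ S, v (Sum.inl j) = 0) →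
        |∑ i, A.mulVec v i ^ 2 - ∑ j, v j ^ 2| ≤ δ * ∑ j, v j ^ 2) :
    HasPartialRIP A.toCols₁ A.toCols₂ t δ := by
  have hmul (x : Fin m → ℝ) (w : Fin r → ℝ) :
      A.mulVec (Sum.elim x w) = A.toCols₁.mulVec x + A.toCols₂.mulVec w := by
    conv_lhs => rw [← Matrix.fromCols_toCols A]
    rw [Matrix.fromCols_mulVec_sumElim]
  have hrank : FullColumnRank A.toCols₂ := by
    rw [FullColumnRank, LinearMap.ker_eq_bot']
    intro w hw
    obtain ⟨S, -, hS⟩ := Finset.exists_subset_card_eq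
      (show t ≤ (Finset.univ : Finset (Fin m)).card by simpa using ht)
    -- At a kernel vector the hypothesis reads `‖w‖² ≤ δ ‖w‖²`, which forces `w = 0` because `δ <
    -- 1`.
    have h1 := h S (by simpa using hS) (Sum.elim 0 w) (fun j _ => rfl)
    have hw' : A.toCols₂.mulVec w = 0 := hw
    rw [hmul, hw'] at h1
    simp only [Matrix.mulVec_zero, add_zero, Pi.zero_apply, Fintype.sum_sum_type, Sum.elim_inl,
      Sum.elim_inr, ne_eq, OfNat.ofNat_ne_zero, not_false_eq_true, zero_pow,
      Finset.sum_const_zero, zero_add, zero_sub, abs_neg] at h1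
    have h0 : 0 ≤ ∑ j, w j ^ 2 := Finset.sum_nonneg fun _ _ => sq_nonneg _
    rw [abs_of_nonneg h0] at h1
    have h2 : ∑ j, w j ^ 2 = 0 := by nlinarith
    ext j
    have := (Finset.sum_eq_zero_iff_of_nonneg fun _ _ => sq_nonneg _).1 h2 j (Finset.mem_univ j)
    simpa using this
  refine ⟨hrank, (ripConstant_le_iff _ _ hδ).2 fun x hx => ?_⟩
  rw [norm_sq_toEuclideanLin, EuclideanSpace.real_norm_sq_eq, ← Matrix.mulVec_mulVec]
  obtain ⟨w, hw, hle⟩ := exists_rangeComplProj_decomp hrank (A.toCols₁.mulVec x.ofLp)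
  obtain ⟨S, hsub, -, hS⟩ := Finset.exists_subsuperset_card_eq
    (Finset.subset_univ (Finset.univ.filter fun j => x j ≠ 0)) hx
    (show t ≤ (Finset.univ : Finset (Fin m)).card by simpa using ht)
  have hxS (j) (hj : j ∉ S) : x j = 0 := by
    by_contra hne
    exact hj (hsub (by simpa using hne))
  -- The lower bound tests `(x, -w)`, whose image is exactly `P A₁ x`; the upper bound tests `(x,
  -- 0)` and uses that `P` does not increase the norm.
  have hlow := h S (by simpa using hS) (Sum.elim x.ofLp (-w)) hxS
  have hupp := h S (by simpa using hS) (Sum.elim x.ofLp 0) hxS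
  rw [hmul, Matrix.mulVec_neg, ← sub_eq_add_neg, ← hw] at hlow
  rw [hmul, Matrix.mulVec_zero, add_zero] at hupp
  simp only [Fintype.sum_sum_type, Sum.elim_inl, Sum.elim_inr, Pi.neg_apply, Pi.zero_apply,
    even_two, Even.neg_pow, ne_eq, OfNat.ofNat_ne_zero, not_false_eq_true, zero_pow,
    Finset.sum_const_zero, add_zero] at hlow hupp
  have hw0 : 0 ≤ ∑ j, w j ^ 2 := Finset.sum_nonneg fun _ _ => sq_nonneg _
  rw [abs_le] at hlow hupp
  constructor
  · nlinarith [hlow.1]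
  · linarith [hupp.2]

/-- The vectors whose support in the first block of coordinates is contained in `S`. -/
def supportedOn {m r : ℕ} (S : Finset (Fin m)) :
    Submodule ℝ (EuclideanSpace ℝ (Fin m ⊕ Fin r)) where
  carrier := {v | ∀ j ∉ S, v (Sum.inl j) = 0}
  add_mem' hv hw j hj := by simp [hv j hj, hw j hj]
  zero_mem' _ _ := rfl
  smul_mem' a v hv j hj := by simp [hv j hj]

theorem finrank_supportedOn_le {m r : ℕ} (S : Finset (Fin m)) :
    Module.finrank ℝ (supportedOn (r := r) S) ≤ S.card + r := by
  let f : supportedOn (r := r) S →ₗ[ℝ] (S ⊕ Fin r → ℝ) :=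
    { toFun := fun v => Sum.elim (fun j => v.1 (Sum.inl j.1)) (fun j => v.1 (Sum.inr j))
      map_add' := fun v w => by ext (j | j) <;> simp
      map_smul' := fun a v => by ext (j | j) <;> simp }
  have hf : Function.Injective f := by
    intro v w hvw
    ext (j | j)
    · by_cases hj : j ∈ S
      · exact congrFun hvw (Sum.inl ⟨j, hj⟩)
      · rw [v.2 j hj, w.2 j hj]
    · exact congrFun hvw (Sum.inr j)
  have := LinearMap.finrank_le_finrank_of_injective hf
  simpa using this

/-! ### Union bound over supports and nets -/

theorem IsGaussianMatrix.measure_not_hasPartialRIP_le {Ω : Type*} [MeasurableSpace Ω] {k m r t : ℕ}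
    {A : Ω → Matrix (Fin k) (Fin m ⊕ Fin r) ℝ} {μ : Measure Ω} (h : IsGaussianMatrix A μ)
    (hk : 0 < k) (ht : t ≤ m) {δ : ℝ} (hδ : 0 < δ) (hδ1 : δ < 1) :
    μ {ω | ¬ HasPartialRIP (A ω).toCols₁ (A ω).toCols₂ t δ} ≤
      ENNReal.ofReal (m.choose t * (9 ^ (t + r) *
        (2 * Real.exp (-(k * ((3 * δ ^ 2 - δ ^ 3) / 48)))))) := by
  have := h.indep_entry.isProbabilityMeasure
  choose net hcard hnorm hnet using fun S : Finset (Fin m) =>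
    exists_quarter_net (supportedOn (r := r) S)
  let bad (S : Finset (Fin m)) (c : supportedOn (r := r) S) : Set Ω :=
    {ω | δ / 2 ≤ |∑ i, (A ω).mulVec c.1.ofLp i ^ 2 - 1|}
  have hsub : {ω | ¬ HasPartialRIP (A ω).toCols₁ (A ω).toCols₂ t δ} ⊆
      ⋃ S ∈ Finset.powersetCard t (Finset.univ : Finset (Fin m)), ⋃ c ∈ net S, bad S c := by
    intro ω hω
    by_contra hcon
    simp only [Set.mem_iUnion, not_exists] at hcon
    refine hω (hasPartialRIP_of_forall_support _ ht hδ hδ1 fun S hS v hv => ?_)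
    let T : supportedOn (r := r) S →ₗ[ℝ] EuclideanSpace ℝ (Fin k) :=
      (Matrix.toEuclideanLin (A ω)).comp (supportedOn S).subtype
    have hT (c : supportedOn (r := r) S) :
        ‖T c‖ ^ 2 = ∑ i, (A ω).mulVec c.1.ofLp i ^ 2 := by
      rw [EuclideanSpace.real_norm_sq_eq]
      rfl
    have hb := abs_normSq_sub_le_of_net T (s := net S) (fun c hc => hnorm S c hc)
      (fun x hx => hnet S x hx) (δ := δ)
      (fun c hc => by rw [hT]; exact (not_le.1 (hcon S hS c hc)).le) ⟨WithLp.toLp 2 v, hv⟩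
    rw [hT, ← Submodule.norm_coe, EuclideanSpace.real_norm_sq_eq] at hb
    exact hb
  have hbad (S : Finset (Fin m)) (c) (hc : c ∈ net S) :
      μ (bad S c) ≤ ENNReal.ofReal (2 * Real.exp (-(k * ((3 * δ ^ 2 - δ ^ 3) / 48)))) := by
    have hc1 : ∑ i, c.1 i ^ 2 = 1 := by
      have h1 := hnorm S c hc
      rw [← EuclideanSpace.real_norm_sq_eq, Submodule.norm_coe, h1, one_pow]
    -- Deviation `δ / 2` on the net, since passing to the whole subspace doubles it; `ε ^ 2 / 4 - ε
    -- ^ 3 / 6` becomes `(3 * δ ^ 2 - δ ^ 3) / 48`.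
    have h2 := h.measureReal_mulVec_sq_le hk hc1 (ε := δ / 2) (by linarith) (by linarith)
    rw [← ofReal_measureReal]
    refine ENNReal.ofReal_le_ofReal (h2.trans_eq ?_)
    congr 3
    ring
  calc μ {ω | ¬ HasPartialRIP (A ω).toCols₁ (A ω).toCols₂ t δ}
      ≤ ∑ S ∈ Finset.powersetCard t (Finset.univ : Finset (Fin m)), ∑ c ∈ net S, μ (bad S c) :=
        (measure_mono hsub).trans <| (measure_biUnion_finset_le _ _).trans <|
          Finset.sum_le_sum fun S _ => measure_biUnion_finset_le _ _
    _ ≤ ∑ S ∈ Finset.powersetCard t (Finset.univ : Finset (Fin m)),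
          ENNReal.ofReal (9 ^ (t + r) * (2 * Real.exp (-(k * ((3 * δ ^ 2 - δ ^ 3) / 48))))) := by
        refine Finset.sum_le_sum fun S hS => ?_
        refine (Finset.sum_le_sum fun c hc => hbad S c hc).trans ?_
        rw [Finset.sum_const, nsmul_eq_mul,
          ENNReal.ofReal_mul (p := (9 : ℝ) ^ (t + r)) (by positivity)]
        gcongr
        have h1 : (net S).card ≤ 9 ^ (t + r) := by
          refine (hcard S).trans (Nat.pow_le_pow_right (by norm_num) ?_)
          rw [← (Finset.mem_powersetCard.1 hS).2]
          exact finrank_supportedOn_le S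
        rw [show ((9 : ℝ) ^ (t + r)) = ((9 ^ (t + r) : ℕ) : ℝ) by push_cast; rfl,
          ENNReal.ofReal_natCast]
        exact_mod_cast h1
    _ = _ := by
        rw [Finset.sum_const, Finset.card_powersetCard, Finset.card_univ, Fintype.card_fin,
          nsmul_eq_mul, ENNReal.ofReal_mul (p := (m.choose t : ℝ)) (by positivity),
          ENNReal.ofReal_natCast]

/-! ### Numerical estimates and conclusion -/

theorem choose_le_exp_mul_log {n t : ℕ} (ht : 0 < t) (htn : t ≤ n) :
    (n.choose t : ℝ) ≤ Real.exp (t * Real.log (n / t * Real.exp 1)) := by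
  have ht' : (0 : ℝ) < t := by exact_mod_cast ht
  have hn' : (0 : ℝ) < n := by exact_mod_cast ht.trans_le htn
  have h1 : (n.choose t : ℝ) ≤ n ^ t / t.factorial := Nat.choose_le_pow_div t n
  have h2 := Real.pow_div_factorial_le_exp (t : ℝ) ht'.le t
  have h3 : Real.exp (t * Real.log (n / t * Real.exp 1)) = (n / t) ^ t * Real.exp t := by
    rw [Real.log_mul (by positivity) (Real.exp_pos 1).ne', Real.log_exp, mul_add, mul_one,
      Real.exp_add, Real.exp_nat_mul, Real.exp_log (by positivity)]
  rw [h3]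
  refine h1.trans ?_
  calc (n : ℝ) ^ t / t.factorial = (n / t) ^ t * (t ^ t / t.factorial) := by
        rw [div_pow]
        field_simp
    _ ≤ _ := by gcongr

/-- Split `log n = log (n / t) + log t` and use `log t ≤ t - 1`. This makes the entropy term large
enough to yield decay in `n`. -/
theorem log_le_mul_log_div {n t : ℕ} (ht : 0 < t) (htn : t ≤ n) :
    Real.log n ≤ t * Real.log (n / t * Real.exp 1) := by
  have ht' : (1 : ℝ) ≤ t := by exact_mod_cast ht
  have hn' : (t : ℝ) ≤ n := by exact_mod_cast htn
  have h0 : 0 < (t : ℝ) := by linarith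
  have h0' : 0 < (n : ℝ) := by linarith
  rw [Real.log_mul (by positivity) (Real.exp_pos 1).ne', Real.log_exp]
  have h1 : 0 ≤ Real.log (n / t) := Real.log_nonneg (by rw [le_div_iff₀ h0]; linarith)
  have h2 : Real.log n = Real.log (n / t) + Real.log t := by
    rw [← Real.log_mul (by positivity) (by positivity), div_mul_cancel₀ _ h0.ne']
  have h3 := Real.log_le_sub_one_of_pos h0
  nlinarith

theorem hasPartialRIP_zero {k m r : ℕ} (A₁ : Matrix (Fin k) (Fin m) ℝ)
    {A₂ : Matrix (Fin k) (Fin r) ℝ} (h : FullColumnRank A₂) {δ : ℝ} (hδ : 0 < δ) :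
    HasPartialRIP A₁ A₂ 0 δ := by
  refine ⟨h, (ripConstant_le_iff _ _ hδ).2 fun x hx => ?_⟩
  have h0 : (fun i => x i) = 0 := hammingNorm_eq_zero.1 (Nat.le_zero.1 hx)
  have : x = 0 := by
    ext i
    exact congrFun h0 i
  subst this
  simp

theorem twelve_le_div {δ : ℝ} (hδ : 0 < δ) (hδ1 : δ < 1) : 12 ≤ 12 / δ := by
  rw [le_div_iff₀ hδ]; linarith

theorem one_le_log_div {δ : ℝ} (hδ : 0 < δ) (hδ1 : δ < 1) : 1 ≤ Real.log (12 / δ) := by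
  rw [Real.le_log_iff_exp_le (by positivity)]
  linarith [Real.exp_one_lt_d9, twelve_le_div hδ hδ1]

theorem one_le_const_div {δ : ℝ} (hδ : 0 < δ) (hδ1 : δ < 1) :
    1 ≤ (2 * 48) / (3 * δ ^ 2 - δ ^ 3) := by
  have h2 : δ ^ 2 ≤ 1 := pow_le_one₀ hδ.le hδ1.le
  have h3 : 0 < δ ^ 2 := by positivity
  have h4 : δ ^ 3 = δ * δ ^ 2 := by ring
  have h5 : 0 < δ ^ 3 := by positivity
  rw [le_div_iff₀ (by nlinarith)]
  linarith

/-- One copy of `a + b` in the exponent absorbs the number of subspaces and net points. The other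
beats `N`, because `N = n + r ≤ n (1 + s) ≤ exp a * 12 ^ s`. -/
theorem union_bound_le {n r s N : ℕ} {c a b : ℝ} (hs : r ≤ s) (hn : 0 < n)
    (hN : N = n + r) {ch : ℝ} (hch : ch ≤ Real.exp a)
    (ha : Real.log n ≤ a) (hb : s * Real.log 12 ≤ b) (hc : 2 * (a + b) ≤ c) :
    ch * (9 ^ s * (2 * Real.exp (-c))) ≤ 2 * (N : ℝ) ^ (-1 : ℝ) := by
  have hn' : (0 : ℝ) < n := by exact_mod_cast hn
  have hpow : (12 : ℝ) ^ s ≤ Real.exp b := by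
    rw [← Real.exp_log (show (0 : ℝ) < 12 by norm_num), ← Real.exp_nat_mul]
    exact Real.exp_le_exp.2 hb
  have h9 : (9 : ℝ) ^ s ≤ Real.exp b := (pow_le_pow_left₀ (by norm_num) (by norm_num) s).trans hpow
  have h12 : (1 : ℝ) + s ≤ 12 ^ s := by
    have := one_add_mul_le_pow (show (-2 : ℝ) ≤ 11 by norm_num) s
    norm_num at this
    have : (0 : ℝ) ≤ s := by positivity
    linarith
  have hNle : (N : ℝ) ≤ Real.exp (a + b) := by
    have h1 : (n : ℝ) ≤ Real.exp a := by
      rw [← Real.exp_log hn']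
      exact Real.exp_le_exp.2 ha
    have h2 : (N : ℝ) ≤ n * (1 + s) := by
      have h3 : (r : ℝ) ≤ s := by exact_mod_cast hs
      have h4 : (1 : ℝ) ≤ n := by exact_mod_cast hn
      have h5 : (0 : ℝ) ≤ s := by positivity
      rw [hN]
      push_cast
      nlinarith
    rw [Real.exp_add]
    exact h2.trans (mul_le_mul h1 (h12.trans hpow) (by positivity) (Real.exp_pos _).le)
  have hN0 : (0 : ℝ) < N := by exact_mod_cast (by omega : 0 < N)
  calc ch * (9 ^ s * (2 * Real.exp (-c)))
      ≤ Real.exp a * (Real.exp b * (2 * Real.exp (-(2 * (a + b))))) := by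
        gcongr
    _ = 2 * (Real.exp (a + b))⁻¹ := by
        rw [← Real.exp_neg, ← mul_assoc, ← Real.exp_add, mul_left_comm, ← Real.exp_add]
        ring_nf
    _ ≤ 2 * (N : ℝ) ^ (-1 : ℝ) := by
        rw [Real.rpow_neg_one]
        gcongr

/-- The constants `C` and `c` are absolute; `A ω = (A₁, A₂)` with `A₁ = (A ω).toCols₁` of size
`k × (N - r)` and `A₂ = (A ω).toCols₂` of size `k × r`. -/
theorem mainTheorem5 :
    ∃ C c : ℝ, 0 < C ∧ 0 < c ∧
      ∀ (N s r k : ℕ) (δ : ℝ), 0 < N → r ≤ s → s ≤ N → 0 < δ → δ < 1 →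
        (k : ℝ) > (2 * 48) / (3 * δ ^ 2 - δ ^ 3) *
          (((s : ℝ) - r) * Real.log (((N : ℝ) - r) / ((s : ℝ) - r) * Real.exp 1) +
            s * Real.log (12 / δ)) →
        ∀ (Ω : Type*) [MeasurableSpace Ω] (μ : Measure Ω) [IsProbabilityMeasure μ]
          (A : Ω → Matrix (Fin k) (Fin (N - r) ⊕ Fin r) ℝ),
          IsGaussianMatrix A μ →
          μ {ω | ¬ HasPartialRIP (A ω).toCols₁ (A ω).toCols₂ (s - r) δ} ≤
            ENNReal.ofReal (C * (N : ℝ) ^ (-c)) := by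
  refine ⟨2, 1, two_pos, one_pos, ?_⟩
  intro N s r k δ hN hrs hsN hδ hδ1 hk Ω _ μ _ A hA
  have hc := one_le_const_div hδ hδ1
  have hlog := one_le_log_div hδ hδ1
  have hs0 : (0 : ℝ) ≤ s := by positivity
  have hsb : (s : ℝ) ≤ s * Real.log (12 / δ) := by nlinarith
  -- For `r = s` the hypothesis bounds `k` below only in terms of `s` and `δ`, so decay in `N`
  -- cannot come from the exponent. It does give `k > r`, and the failure event is null.
  rcases hrs.eq_or_lt with rfl | hlt
  · simp only [sub_self, zero_mul, zero_add] at hk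
    have hrk : (r : ℝ) < k := by nlinarith
    have hrk' : r < k := by exact_mod_cast hrk
    rw [Nat.sub_self]
    refine (le_of_eq ?_).trans zero_le
    refine measure_mono_null (fun ω hω (hrank : FullColumnRank (A ω).toCols₂) => hω ?_)
      (ae_iff.1 (hA.ae_fullColumnRank (by omega) hrk'.le))
    exact hasPartialRIP_zero _ hrank hδ
  · have ht : 0 < s - r := by omega
    have htn : s - r ≤ N - r := by omega
    have hch := choose_le_exp_mul_log ht htn
    have ha := log_le_mul_log_div ht htn
    rw [← Nat.cast_sub hrs, ← Nat.cast_sub (hrs.trans hsN)] at hk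
    set a : ℝ := ((s - r : ℕ) : ℝ) *
      Real.log (((N - r : ℕ) : ℝ) / ((s - r : ℕ) : ℝ) * Real.exp 1) with ha_def
    have ha0 : 0 ≤ a := (Real.log_natCast_nonneg _).trans ha
    have hk0 : (0 : ℝ) < k := by nlinarith
    have hden : 0 < 3 * δ ^ 2 - δ ^ 3 := by nlinarith [pow_pos hδ 2]
    refine (hA.measure_not_hasPartialRIP_le (by exact_mod_cast hk0) htn hδ hδ1).trans
      (ENNReal.ofReal_le_ofReal ?_)
    rw [Nat.sub_add_cancel hrs]
    refine union_bound_le hrs (by omega) (by omega) hch ha (b := s * Real.log (12 / δ)) ?_ ?_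
    · gcongr
      exact twelve_le_div hδ hδ1
    -- Clearing the denominator, the factor `2 * 48` in the hypothesis is exactly what makes the
    -- exponent at least `2 * (a + b)`.
    · rw [gt_iff_lt, div_mul_eq_mul_div, div_lt_iff₀ hden] at hk
      linarith
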